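/- **Set-up.** Let $K=(\mathbb C^\times)^{r}$ be a torus with cocharacter lattice $\mathbb L$, let $D_1,\dots,D_m\in\mathbb L^\vee$ be characters, acting on $\mathbb C^m$, and for $\omega\in\sum_i\mathbb R_{\ge0}D_i$ put $\angle_I=\{\sum_{i\in I}a_iD_i: a_i>0\}$, $\mathcal A_\omega=\{I:\omega\in\angle_I\}$, $C_\omega=\bigcap_{I\in\mathcal A_\omega}\angle_I$, $\mathcal U_\omega=\{z\in\mathbb C^m: \exists I\in\mathcal A_\omega,\ z_i\ne0\ \forall i\in I\}$, $X_\omega=[\mathcal U_\omega/K]$, $S_\omega=\{i:\{1,\dots,m\}\setminus\{i\}\notin\mathcal A_\omega\}$ and $\mathbb K_\omega=\{d\in\mathbb L\otimes\mathbb Q:\{i: D_i\cdot d\in\mathbb Z\}\in\mathcal A_\omega\}$. Let $\omega_\pm$ be stability conditions whose chambers $C_\pm=C_{\omega_\pm}$ have maximal dimension and are separated by a hyperplane $W=e^\perp$, with $e\in\mathbb L$ primitive and $\pm\,\omega_\pm\cdot e>0$, such that $\overline{C_W}:=W\cap\overline{C_+}=W\cap\overline{C_-}$ is a common facet. Write $X_\pm$,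 $S_\pm$, $\mathbb K_\pm$ for the objects of $\omega_\pm$, and put $M_0=\{i:D_i\cdot e=0\}$, $M_\pm=\{i:\pm D_i\cdot e>0\}$, $I_\pm=(M_+\cup M_-)\setminus S_\pm$, $D_\pm=\sum_{i\in I_\pm}\{z_i=0\}\subset X_\pm$. The pairs $(X_\pm,D_\pm)$ are taken without the extended variables of the indices $i\in S_\pm\cap(M_+\cup M_-)$, i.e. only degrees in $\mathbb K_\pm^{\rm rel}:=\{d\in\mathbb K_\pm: D_i\cdot d=0\ \forall i\in S_\pm\cap (M_+\cup M_-)\}$ are used. Let $E_1,\dots,E_k\in\mathbb L^\vee$ be characters in $\overline{C_W}$ whose line bundles on $X_\pm$ are pulled back from the coarse moduli spaces; let $v_j$ be their first Chern classes; let $s_\pm$ be regular sections of the direct sums of these line bundles on $X_\pm$ that agree on the common open set of $X_\pm$; and let $Y_\pm\subset X_\pm$ be the zero loci of $s_\pm$, $D_{Y,\pm}=D_\pm\cap Y_\pm$. Let $p_1^\pm,\dots,p_r^\pm$ be integral bases of $\tilde{\mathbb L}_\pm^\vee=\{p\in\mathbb L^\vee:p\cdot d\in\mathbb Z\ \forall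 d\in\mathbb K_\pm\}$ lying in $\overline{C_\pm}$, with $p_i^+=p_i^-\in\overline{C_W}$ for $i<r$. Put $c=-\,p_r^+\cdot e/p_r^-\cdot e$. For $d\in \mathbb L\otimes\mathbb Q$ let $[d]$ be its class modulo $\mathbb L$. For a sector $f$ and contact orders $\vec d\in\mathbb Q^{I_\pm}$, the component of the relative $H$-function is $$H_{(Y_\pm,D_{Y,\pm}),f,\vec d}=e^{t_\pm/2\pi i}\sum_{d}y_\pm^{d}\;\frac{\prod_{j=1}^k\Gamma\!\left(1+\frac{v_j}{2\pi i}+v_j\cdot d\right)}{\prod_{i\in M_0}\Gamma\!\left(1+\frac{D_i}{2\pi i}+D_i\cdot d\right)},\qquad t_\pm=\sum_a p_a^\pm\log y_{\pm,a},\quad y_\pm^d=\prod_a y_{\pm,a}^{p_a^\pm\cdot d},$$ summed over $d\in\mathbb K^{\rm rel}_\pm$ with $[d]=f$, $(D_i\cdot d)_{i\in I_\pm}=\vec d$ and $v_j\cdot d\ge0$ for all $j$; here $y_+=y$, $y_-=\tilde y$. It is a formal series in generalised monomials, with coefficients depending on the $\log y_{\pm,a}$. Its defining expression has coefficients in the completion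 $\mathbb C[[\mathbb L^\vee]]$ of $H_K^*(\mathrm{pt})$ (characters being degree-two classes), and the component itself is the image of this expression in the ambient part of the cohomology of the stratum of $Y_\pm$ cut out by the $z_i$ with $D_i\cdot f\notin\mathbb Z$ and the $z_i$, $i\in I_\pm$, with $d_i\ne0$, i.e. in the image of $\mathbb C[[\mathbb L^\vee]]$ in that cohomology. **Theorem.** One has $c>0$, and there are $c_1,\dots,c_{r-1}\in\mathbb Q$ with $p_r^+=\sum_{i<r}c_ip_i^--c\,p_r^-$ such that the following holds under the change of variables $$\tilde y_i=y_iy_r^{c_i}\ (i<r),\qquad \tilde y_r=y_r^{-c}.$$ For all $d_+\in\mathbb K_+^{\rm rel}$ and $d_-\in\mathbb K_-^{\rm rel}$ with $d_+-d_-\in\mathbb Qe$, put $f_\pm=[d_\pm]$ and $\vec d_\pm=(D_i\cdot d_\pm)_{i\in I_\pm}$. Then $$H_{(Y_+,D_{Y,+}),f_+,\vec d_+}=y_r^{\,p_r^+\cdot(d_+-d_-)}\;H_{(Y_-,D_{Y,-}),f_-,\vec d_-}$$ as an identity of the defining expressions with coefficients in $\mathbb C[[\mathbb L^\vee]]$.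 Consequently the component on each side is the image, in the ambient cohomology of its own stratum, of the expression on the other side. In particular, if $d_+=d_-$, the two expressions are equal. -/

import Mathlib

noncomputable section

namespace ToricWall

section Defs

variable {r m k n : ℕ}

/-! ### The torus `K = (ℂˣ)^r`, its lattices and its action on `ℂ^m`

The cocharacter lattice is `𝕃 = ℤ^r` and the character lattice is `𝕃^∨ = ℤ^r`. -/

/-- The pairing `χ · x` of a character `χ ∈ 𝕃^∨` with `x ∈ 𝕃 ⊗ R`. (The same dot product also pairs
an element of `𝕃` with an element of `𝕃^∨ ⊗ R`.) -/
def pair {R : Type*} [Ring R] (χ : Fin r → ℤ) (x : Fin r → R) : R := ∑ a, (χ a : R) * x a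

/-- The value of the character `χ` at a point `t` of the torus `K`. -/
def charEval (χ : Fin r → ℤ) (t : Fin r → ℂˣ) : ℂ := ∏ a, ((t a ^ χ a : ℂˣ) : ℂ)

/-- The action of `K` on `ℂ^m` through the characters `D_1, …, D_m`. -/
def act (D : Fin m → Fin r → ℤ) (t : Fin r → ℂˣ) (z : Fin m → ℂ) : Fin m → ℂ :=
  fun i => charEval (D i) t * z i

/-! ### Stability conditions and chambers -/

/-- The cone `∠_I = {∑_{i ∈ I} a_i D_i : a_i > 0}` in `𝕃^∨ ⊗ ℝ`. -/
def angle (D : Fin m → Fin r → ℤ) (I : Finset (Fin m)) : Set (Fin r → ℝ) :=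
  {θ | ∃ a : Fin m → ℝ, (∀ i ∈ I, 0 < a i) ∧ ∀ b, θ b = ∑ i ∈ I, a i * (D i b : ℝ)}

/-- The set `𝒜_ω` of anticones. -/
def anticones (D : Fin m → Fin r → ℤ) (ω : Fin r → ℝ) : Set (Finset (Fin m)) :=
  {I | ω ∈ angle D I}

/-- The extended ample cone `C_ω`. -/
def chamber (D : Fin m → Fin r → ℤ) (ω : Fin r → ℝ) : Set (Fin r → ℝ) :=
  ⋂ I ∈ anticones D ω, angle D I

/-- The semistable locus `𝒰_ω ⊆ ℂ^m`; the toric stack is `X_ω = [𝒰_ω / K]`. -/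
def semistable (D : Fin m → Fin r → ℤ) (ω : Fin r → ℝ) : Set (Fin m → ℂ) :=
  {z | ∃ I ∈ anticones D ω, ∀ i ∈ I, z i ≠ 0}

/-- The set `S_ω` of extended indices: those `i` for which the divisor `{z_i = 0}` of `X_ω`
is empty. -/
def extended (D : Fin m → Fin r → ℤ) (ω : Fin r → ℝ) : Set (Fin m) :=
  {i | ({i}ᶜ : Finset (Fin m)) ∉ anticones D ω}

/-- The set `𝕂_ω` of those `d ∈ 𝕃 ⊗ ℚ` for which `{i : D_i · d ∈ ℤ}` is an anticone. -/
def KSet (D : Fin m → Fin r → ℤ) (ω : Fin r → ℝ) : Set (Fin r → ℚ) :=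
  {d | ∃ I ∈ anticones D ω, ∀ i, i ∈ I ↔ ∃ a : ℤ, pair (D i) d = a}

/-- The hyperplane `W = e^⊥` in `𝕃^∨ ⊗ ℝ`. -/
def wall (e : Fin r → ℤ) : Set (Fin r → ℝ) := {θ | pair e θ = 0}

/-- The chambers of the stability conditions `ω₊` and `ω₋` are of maximal dimension and are
separated by the hyperplane wall `W = e^⊥`, along a common facet of their closures; `e ∈ 𝕃` is
primitive, positive on `ω₊` and negative on `ω₋`. -/
structure IsWallCrossing (D : Fin m → Fin r → ℤ) (ωp ωm : Fin r → ℝ) (e : Fin r → ℤ) : Prop where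
  effective_p : ∃ a : Fin m → ℝ, (∀ i, 0 ≤ a i) ∧ ∀ b, ωp b = ∑ i, a i * (D i b : ℝ)
  effective_m : ∃ a : Fin m → ℝ, (∀ i, 0 ≤ a i) ∧ ∀ b, ωm b = ∑ i, a i * (D i b : ℝ)
  maximal_p : (interior (chamber D ωp)).Nonempty
  maximal_m : (interior (chamber D ωm)).Nonempty
  primitive : ∀ (c : ℤ) (e' : Fin r → ℤ), e = c • e' → IsUnit c
  pos : 0 < pair e ωp
  neg : pair e ωm < 0
  side_p : ∀ θ ∈ chamber D ωp, 0 ≤ pair e θ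
  side_m : ∀ θ ∈ chamber D ωm, pair e θ ≤ 0
  common : wall e ∩ closure (chamber D ωp) = wall e ∩ closure (chamber D ωm)
  facet : (Submodule.span ℝ (wall e ∩ closure (chamber D ωp)) : Set (Fin r → ℝ)) = wall e

/-- The set `(M₊ ∪ M₋) ∖ S_ω`, where `M₊ ∪ M₋ = {i : D_i · e ≠ 0}`: the indices of the irreducible
components `{z_i = 0}` of the divisor `D_±` of `X_ω`. -/
def relDivisors (D : Fin m → Fin r → ℤ) (ω : Fin r → ℝ) (e : Fin r → ℤ) : Set (Fin m) :=
  {i | pair (D i) e ≠ 0 ∧ i ∉ extended D ω}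

/-! ### Complete intersections -/

/-- `s` is a section over `X_ω` of the line bundle of the character `χ`: a regular function on `𝒰_ω`
on which `K` acts through `χ`. -/
structure IsSection (D : Fin m → Fin r → ℤ) (ω : Fin r → ℝ) (χ : Fin r → ℤ)
    (s : (Fin m → ℂ) → ℂ) : Prop where
  regular : ∀ z ∈ semistable D ω, ∃ p q : MvPolynomial (Fin m) ℂ, MvPolynomial.eval z q ≠ 0 ∧
    ∀ w ∈ semistable D ω, MvPolynomial.eval w q ≠ 0 →
      s w * MvPolynomial.eval w q = MvPolynomial.eval w p
  equivariant : ∀ t : Fin r → ℂˣ, ∀ z ∈ semistable D ω, s (act D t z) = charEval χ t * s z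

/-- The preimage in `𝒰_ω` of the zero locus `Y` in `X_ω` of the section `(s_1, …, s_k)`. -/
def zeroLocus (D : Fin m → Fin r → ℤ) (ω : Fin r → ℝ) (s : Fin k → (Fin m → ℂ) → ℂ) :
    Set (Fin m → ℂ) :=
  {z | z ∈ semistable D ω ∧ ∀ j, s j z = 0}

/-- The prime ideal of the polynomials that vanish at `z`. -/
abbrev pointIdeal (z : Fin m → ℂ) : Ideal (MvPolynomial (Fin m) ℂ) :=
  RingHom.ker (MvPolynomial.eval z)

instance pointIdeal_isPrime (z : Fin m → ℂ) : (pointIdeal z).IsPrime := RingHom.ker_isPrime _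

/-- The section `(s_1, …, s_k)` is regular: at every point `z` of its zero locus, the numerators `p_j`
of `s_j = p_j / q_j` with `q_j(z) ≠ 0` form a regular sequence in the local ring of `ℂ^m` at `z`. -/
def IsRegularSection (D : Fin m → Fin r → ℤ) (ω : Fin r → ℝ) (s : Fin k → (Fin m → ℂ) → ℂ) : Prop :=
  ∀ z ∈ zeroLocus D ω s, ∀ p q : Fin k → MvPolynomial (Fin m) ℂ,
    (∀ j, MvPolynomial.eval z (q j) ≠ 0 ∧ ∀ w ∈ semistable D ω, MvPolynomial.eval w (q j) ≠ 0 →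
      s j w * MvPolynomial.eval w (q j) = MvPolynomial.eval w (p j)) →
    RingTheory.Sequence.IsRegular (Localization.AtPrime (pointIdeal z))
      (List.ofFn fun j => algebraMap (MvPolynomial (Fin m) ℂ)
        (Localization.AtPrime (pointIdeal z)) (p j))

/-- The line bundle on `X_ω` of the character `χ` is pulled back from the coarse moduli space:
the stabilisers of all points act trivially on its fibres. -/
def FromCoarse (D : Fin m → Fin r → ℤ) (ω : Fin r → ℝ) (χ : Fin r → ℤ) : Prop :=
  ∀ z ∈ semistable D ω, ∀ t : Fin r → ℂˣ, act D t z = z → charEval χ t = 1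

/-- The assumptions on the complete intersections `Y_± ⊆ X_±`: the characters `E_j` lie in
`W ∩ closure C₊ = W ∩ closure C₋`, their line bundles are pulled back from the coarse moduli spaces,
and the `s_±` are regular sections that agree where the birational map `X₊ ⇢ X₋` is the
identity. -/
structure IsCompatibleCI (D : Fin m → Fin r → ℤ) (ωp ωm : Fin r → ℝ) (e : Fin r → ℤ)
    (E : Fin k → Fin r → ℤ) (sp sm : Fin k → (Fin m → ℂ) → ℂ) : Prop where
  mem_wall : ∀ j, (fun b => (E j b : ℝ)) ∈ wall e ∩ closure (chamber D ωp)
  coarse_p : ∀ j, FromCoarse D ωp (E j)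
  coarse_m : ∀ j, FromCoarse D ωm (E j)
  section_p : ∀ j, IsSection D ωp (E j) (sp j)
  section_m : ∀ j, IsSection D ωm (E j) (sm j)
  regular_p : IsRegularSection D ωp sp
  regular_m : IsRegularSection D ωm sm
  compatible : ∀ j, ∀ z ∈ semistable D ωp ∩ semistable D ωm, sp j z = sm j z

/-! ### Equivariant cohomology and the Kirwan map

For a `K`-invariant closed subset `Z` of a semistable locus, the cohomology of the stack `[Z/K]` with
complex coefficients is the equivariant cohomology `H_K(Z) = H_{K_c}(Z)`, `K_c = (S^1)^r`, and
`H_{K_c}(Z)` is the colimit of `H_{K_c}(V)` over the invariant open neighbourhoods `V` of `Z`.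
The latter groups are computed by the Cartan complex `(Sym(𝔨^∨) ⊗ Ω(V))^{K_c}` with the differential
`d - ι_ξ`. The ambient part of `H_K(Z)` is the image of
`H_K(pt) = Sym(𝕃^∨ ⊗ ℂ) = ℂ[ξ_1, …, ξ_r]`, in which a character `χ` is the first Chern class
`∑ χ_a ξ_a` of its line bundle; the kernel consists of the polynomials that become exact in the Cartan
complex of some neighbourhood. (The kernel is homogeneous, so that the normalisation of the generators
of the action is immaterial.) -/

/-- Complex-valued alternating `j`-forms on the real vector space `ℂ^m`. -/
abbrev Form (m j : ℕ) : Type := (Fin m → ℂ) [⋀^Fin j]→L[ℝ] ℂ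

/-- The inclusion of the compact torus `K_c` in `K`. -/
def unitTorus (t : Fin r → Circle) : Fin r → ℂˣ := fun a => Circle.toUnits (t a)

/-- The action of an element of `K_c` as a real linear map. -/
def actCLM (D : Fin m → Fin r → ℤ) (t : Fin r → Circle) : (Fin m → ℂ) →L[ℝ] (Fin m → ℂ) :=
  ContinuousLinearMap.pi fun i =>
    charEval (D i) (unitTorus t) • (ContinuousLinearMap.proj i : (Fin m → ℂ) →L[ℝ] ℂ)

lemma actCLM_apply (D : Fin m → Fin r → ℤ) (t : Fin r → Circle) (z : Fin m → ℂ) :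
    actCLM D t z = act D (unitTorus t) z := by
  ext i; simp [actCLM, act]

/-- The vector field on `ℂ^m` generated by `ξ ∈ Lie(K_c) = 𝕃 ⊗ ℝ`. -/
def infAct (D : Fin m → Fin r → ℤ) (ξ : Fin r → ℝ) (z : Fin m → ℂ) : Fin m → ℂ :=
  fun i => Complex.I * (pair (D i) ξ : ℝ) * z i

/-- `α = (α_j)_j`, where `α_j` is the component of form degree `j`, is an element of
`(Sym(𝔨^∨) ⊗ Ω(V))^{K_c}`. -/
structure IsEquivariantForm (D : Fin m → Fin r → ℤ) (V : Set (Fin m → ℂ))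
    (α : ∀ j : ℕ, (Fin r → ℝ) → (Fin m → ℂ) → Form m j) : Prop where
  poly : ∀ j, ∃ (N : ℕ) (q : Fin N → MvPolynomial (Fin r) ℂ) (c : Fin N → (Fin m → ℂ) → Form m j),
    (∀ i, ContDiffOn ℝ (⊤ : ℕ∞) (c i) V) ∧
      ∀ ξ, ∀ z ∈ V, α j ξ z = ∑ i, MvPolynomial.eval (fun a => (ξ a : ℂ)) (q i) • c i z
  invariant : ∀ j (t : Fin r → Circle) ξ, ∀ z ∈ V,
    (α j ξ (act D (unitTorus t) z)).compContinuousLinearMap (actCLM D t) = α j ξ z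

/-- The Cartan differential `(d_K α)(ξ) = d(α(ξ)) - ι_ξ α(ξ)`. -/
def cartanD (D : Fin m → Fin r → ℤ) (α : ∀ j : ℕ, (Fin r → ℝ) → (Fin m → ℂ) → Form m j) :
    ∀ j : ℕ, (Fin r → ℝ) → (Fin m → ℂ) → Form m j
  | 0, ξ, z => -(α 1 ξ z).curryLeft (infAct D ξ z)
  | j + 1, ξ, z => extDeriv (α j ξ) z - (α (j + 2) ξ z).curryLeft (infAct D ξ z)

/-- The image `q · 1` of `q ∈ H_K(pt)` in the Cartan complex. -/
def polyForm (q : MvPolynomial (Fin r) ℂ) : ∀ j : ℕ, (Fin r → ℝ) → (Fin m → ℂ) → Form m j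
  | 0, ξ, _ => ContinuousAlternatingMap.constOfIsEmpty ℝ (Fin m → ℂ) (Fin 0)
      (MvPolynomial.eval (fun a => (ξ a : ℂ)) q)
  | _ + 1, _, _ => 0

/-- The class `q ∈ H_K(pt)` restricts to zero in `H_K(Z)`. -/
def IsExactNear (D : Fin m → Fin r → ℤ) (Z : Set (Fin m → ℂ)) (q : MvPolynomial (Fin r) ℂ) : Prop :=
  ∃ V : Set (Fin m → ℂ), IsOpen V ∧ Z ⊆ V ∧ (∀ t : Fin r → Circle, ∀ z ∈ V, act D (unitTorus t) z ∈ V) ∧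
    ∃ α : ∀ j : ℕ, (Fin r → ℝ) → (Fin m → ℂ) → Form m j, IsEquivariantForm D V α ∧
      ∀ j ξ, ∀ z ∈ V, cartanD D α j ξ z = polyForm q j ξ z

lemma IsEquivariantForm.differentiableAt {D : Fin m → Fin r → ℤ} {V : Set (Fin m → ℂ)}
    {α : ∀ j : ℕ, (Fin r → ℝ) → (Fin m → ℂ) → Form m j} (h : IsEquivariantForm D V α)
    (hV : IsOpen V) (j : ℕ) (ξ : Fin r → ℝ) {z : Fin m → ℂ} (hz : z ∈ V) :
    DifferentiableAt ℝ (α j ξ) z := by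
  obtain ⟨N, q, c, hc, he⟩ := h.poly j
  have h1 : DifferentiableAt ℝ
      (fun z => ∑ i, MvPolynomial.eval (fun a => (ξ a : ℂ)) (q i) • c i z) z := by
    refine DifferentiableAt.fun_sum fun i _ => DifferentiableAt.fun_const_smul ?_ _
    exact ((hc i).contDiffAt (hV.mem_nhds hz)).differentiableAt (by simp)
  refine h1.congr_of_eventuallyEq ?_
  filter_upwards [hV.mem_nhds hz] with w hw using he ξ w hw

lemma IsExactNear.zero (D : Fin m → Fin r → ℤ) (Z : Set (Fin m → ℂ)) : IsExactNear D Z 0 := by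
  refine ⟨Set.univ, isOpen_univ, Set.subset_univ _, by simp, fun _ _ _ => 0, ⟨?_, ?_⟩, ?_⟩
  · intro j
    exact ⟨0, Fin.elim0, Fin.elim0, fun i => i.elim0, by simp⟩
  · intro j t ξ z _
    ext v; simp
  · rintro (_ | j) ξ z _
    · ext v; simp [cartanD, polyForm]
    · have : extDeriv (fun _ : Fin m → ℂ => (0 : Form m j)) z = 0 := by
        have h0 := extDeriv_smul (x := z) (0 : ℝ) (fun _ : Fin m → ℂ => (0 : Form m j))
        rw [zero_smul, zero_smul] at h0
        exact h0
      ext v; simp [cartanD, polyForm, this]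

lemma IsExactNear.add {D : Fin m → Fin r → ℤ} {Z : Set (Fin m → ℂ)} {p q : MvPolynomial (Fin r) ℂ}
    (hp : IsExactNear D Z p) (hq : IsExactNear D Z q) : IsExactNear D Z (p + q) := by
  obtain ⟨V, hV, hZ, hi, α, hα, hd⟩ := hp
  obtain ⟨V', hV', hZ', hi', α', hα', hd'⟩ := hq
  refine ⟨V ∩ V', hV.inter hV', Set.subset_inter hZ hZ',
    fun t z hz => ⟨hi t z hz.1, hi' t z hz.2⟩, fun j ξ z => α j ξ z + α' j ξ z, ⟨?_, ?_⟩, ?_⟩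
  · intro j
    obtain ⟨N, f, c, hc, he⟩ := hα.poly j
    obtain ⟨N', f', c', hc', he'⟩ := hα'.poly j
    refine ⟨N + N', Fin.append f f', Fin.append c c', ?_, ?_⟩
    · intro i
      refine Fin.addCases (fun i => ?_) (fun i => ?_) i
      · simpa using (hc i).mono Set.inter_subset_left
      · simpa using (hc' i).mono Set.inter_subset_right
    · intro ξ z hz
      simp [Fin.sum_univ_add, he ξ z hz.1, he' ξ z hz.2]
  · intro j t ξ z hz
    rw [← hα.invariant j t ξ z hz.1, ← hα'.invariant j t ξ z hz.2]
    rfl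
  · rintro (_ | j) ξ z hz
    · have h1 := hd 0 ξ z hz.1
      have h2 := hd' 0 ξ z hz.2
      simp only [cartanD, polyForm] at h1 h2 ⊢
      have h3 := congrArg₂ (· + ·) h1 h2
      ext v
      have h4 := congrArg (fun f => f v) h3
      simp at h4 ⊢
      rw [← h4]; ring
    · have h1 := hd (j + 1) ξ z hz.1
      have h2 := hd' (j + 1) ξ z hz.2
      have h5 := extDeriv_fun_add (hα.differentiableAt hV j ξ hz.1)
        (hα'.differentiableAt hV' j ξ hz.2)
      simp only [cartanD, polyForm] at h1 h2 ⊢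
      have h3 := congrArg₂ (· + ·) h1 h2
      rw [h5]
      ext v
      have h4 := congrArg (fun f => f v) h3
      simp at h4 ⊢
      linear_combination h4

lemma IsExactNear.mul {D : Fin m → Fin r → ℤ} {Z : Set (Fin m → ℂ)} {q : MvPolynomial (Fin r) ℂ}
    (p : MvPolynomial (Fin r) ℂ) (hq : IsExactNear D Z q) : IsExactNear D Z (p * q) := by
  obtain ⟨V, hV, hZ, hi, α, hα, hd⟩ := hq
  refine ⟨V, hV, hZ, hi,
    fun j ξ z => MvPolynomial.eval (fun a => (ξ a : ℂ)) p • α j ξ z, ⟨?_, ?_⟩, ?_⟩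
  · intro j
    obtain ⟨N, f, c, hc, he⟩ := hα.poly j
    refine ⟨N, fun i => p * f i, c, hc, ?_⟩
    intro ξ z hz
    simp [he ξ z hz, Finset.smul_sum, mul_smul]
  · intro j t ξ z hz
    rw [← hα.invariant j t ξ z hz]
    rfl
  · rintro (_ | j) ξ z hz
    · have h1 := hd 0 ξ z hz
      simp only [cartanD, polyForm] at h1 ⊢
      ext v
      have h4 := congrArg (fun f => f v) h1
      simp at h4 ⊢
      rw [← h4]; ring
    · have h1 := hd (j + 1) ξ z hz
      have h5 : extDeriv (fun z => MvPolynomial.eval (fun a => (ξ a : ℂ)) p • α j ξ z) z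
          = MvPolynomial.eval (fun a => (ξ a : ℂ)) p • extDeriv (α j ξ) z := by
        have hdf := hα.differentiableAt hV j ξ hz
        ext v
        simp only [extDeriv]
        rw [fderiv_fun_const_smul hdf]
        simp [ContinuousAlternatingMap.alternatizeUncurryFin_apply, Finset.mul_sum]
      simp only [cartanD, polyForm] at h1 ⊢
      rw [h5]
      ext v
      have h4 := congrArg (fun f => f v) h1
      simp at h4 ⊢
      linear_combination (MvPolynomial.eval (fun a => (ξ a : ℂ)) p) * h4

/-- The homogeneous part of degree `j` of a power series, as a polynomial. -/
def homPart (j : ℕ) (φ : MvPowerSeries (Fin r) ℂ) : MvPolynomial (Fin r) ℂ :=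
  MvPowerSeries.truncTotal (j + 1) (MvPowerSeries.homogeneousComponent j φ)

lemma coeff_homPart (j : ℕ) (φ : MvPowerSeries (Fin r) ℂ) (ν : Fin r →₀ ℕ) :
    (homPart j φ).coeff ν = if ν.degree = j then φ.coeff ν else 0 := by
  rw [homPart, MvPowerSeries.coeff_truncTotal_eq_ite, MvPowerSeries.coeff_homogeneousComponent]
  split_ifs <;> first | rfl | omega

lemma homPart_mul (j : ℕ) (φ ψ : MvPowerSeries (Fin r) ℂ) :
    homPart j (φ * ψ) =
      ∑ x ∈ Finset.HasAntidiagonal.antidiagonal j, homPart x.1 φ * homPart x.2 ψ := by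
  ext ν
  simp only [coeff_homPart, MvPolynomial.coeff_sum, MvPolynomial.coeff_mul, MvPowerSeries.coeff_mul]
  rw [Finset.sum_comm]
  have key : ∀ y ∈ Finset.HasAntidiagonal.antidiagonal ν,
      (∑ x ∈ Finset.HasAntidiagonal.antidiagonal j,
        (if y.1.degree = x.1 then φ.coeff y.1 else 0) *
          (if y.2.degree = x.2 then ψ.coeff y.2 else 0)) =
      if ν.degree = j then φ.coeff y.1 * ψ.coeff y.2 else 0 := by
    intro y hy
    have hy' : y.1.degree + y.2.degree = ν.degree := by
      rw [← Finset.HasAntidiagonal.mem_antidiagonal.mp hy]; simp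
    split_ifs with h
    · rw [Finset.sum_eq_single (y.1.degree, y.2.degree)]
      · simp
      · intro x _ hx
        by_cases h1 : y.1.degree = x.1
        · have : y.2.degree ≠ x.2 := fun h2 => hx (Prod.ext h1.symm h2.symm)
          simp [this]
        · simp [h1]
      · intro h'
        exact absurd (Finset.HasAntidiagonal.mem_antidiagonal.mpr (hy'.trans h)) h'
    · refine Finset.sum_eq_zero fun x hx => ?_
      have hx' := Finset.HasAntidiagonal.mem_antidiagonal.mp hx
      by_cases h1 : y.1.degree = x.1
      · have : y.2.degree ≠ x.2 := by omega
        simp [this]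
      · simp [h1]
  rw [Finset.sum_congr rfl key]
  split_ifs <;> simp

/-- The kernel of the restriction map from `∏_j H_K^{2j}(pt) = ℂ[[ξ_1, …, ξ_r]]` to
`∏_j H_K^{2j}(Z)`. -/
def kirwanKernel (D : Fin m → Fin r → ℤ) (Z : Set (Fin m → ℂ)) : Ideal (MvPowerSeries (Fin r) ℂ) where
  carrier := {φ | ∀ j, IsExactNear D Z (homPart j φ)}
  zero_mem' := fun j => by simpa [homPart] using IsExactNear.zero D Z
  add_mem' := fun h h' j => by simpa [homPart] using (h j).add (h' j)
  smul_mem' := fun φ ψ h j => by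
    rw [smul_eq_mul, homPart_mul]
    refine Finset.sum_induction _ _ (fun _ _ => IsExactNear.add) (IsExactNear.zero D Z) ?_
    exact fun x _ => (h x.2).mul _

/-- The ambient part of the cohomology ring of `[Z/K]`. -/
abbrev AmbientCohomology (D : Fin m → Fin r → ℤ) (Z : Set (Fin m → ℂ)) : Type :=
  MvPowerSeries (Fin r) ℂ ⧸ kirwanKernel D Z

/-! ### Variables -/

/-- The lattice `𝕃̃^∨ = {p ∈ 𝕃^∨ : p · d ∈ ℤ for all d ∈ 𝕂_ω}`. -/
def dualLattice (D : Fin m → Fin r → ℤ) (ω : Fin r → ℝ) : Set (Fin r → ℤ) :=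
  {p | ∀ d ∈ KSet D ω, ∃ a : ℤ, pair p d = a}

/-- `p` is an integral basis of `𝕃̃^∨` that lies in the closure of the chamber of `ω`. -/
structure IsNefBasis (D : Fin m → Fin r → ℤ) (ω : Fin r → ℝ) (p : Fin r → Fin r → ℤ) : Prop where
  linearIndependent : LinearIndependent ℤ p
  span_eq : (Submodule.span ℤ (Set.range p) : Set (Fin r → ℤ)) = dualLattice D ω
  nef : ∀ a, (fun b => (p a b : ℝ)) ∈ closure (chamber D ω)

/-- The bases `p^±` of `𝕃̃_±^∨`, the first `r - 1` elements of which agree and lie on the wall. -/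
structure AreWallBases (D : Fin m → Fin (n + 1) → ℤ) (ωp ωm : Fin (n + 1) → ℝ)
    (e : Fin (n + 1) → ℤ) (pp pm : Fin (n + 1) → Fin (n + 1) → ℤ) : Prop where
  basis_p : IsNefBasis D ωp pp
  basis_m : IsNefBasis D ωm pm
  common : ∀ i : Fin n, pp i.castSucc = pm i.castSucc
  mem_wall : ∀ i : Fin n, (fun b => (pp i.castSucc b : ℝ)) ∈ wall e ∩ closure (chamber D ωp)

/-- Formal series in generalised monomials `y^ν`, `ν ∈ ℚ^r`, with coefficients in `A` that may also
depend on the logarithms `log y_1, …, log y_r`: to `ν` and to values `ℓ_a` of the `log y_a` it assigns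
the coefficient of `y^ν`. -/
abbrev LogSeries (r : ℕ) (A : Type) : Type := (Fin r → ℚ) → (Fin r → ℂ) → A

/-- The exponents of the change of variables `ỹ_i = y_i y_r^{c_i}` for `i < r`, `ỹ_r = y_r^{-c}`; that is,
`ỹ_a = ∏_b y_b^{A_ab}` for the matrix `A`. -/
def changeMatrix (cs : Fin n → ℚ) (c : ℚ) : Matrix (Fin (n + 1)) (Fin (n + 1)) ℚ :=
  Matrix.of (Fin.snoc (α := fun _ => Fin (n + 1) → ℚ)
    (fun i => Fin.snoc (α := fun _ => ℚ) (Pi.single i 1) (cs i))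
    (Fin.snoc (α := fun _ => ℚ) 0 (-c)))

/-- Substitution of `ỹ_a = ∏_b y_b^{A_ab}` in a series in `ỹ`, for an invertible matrix `A`: as
`ỹ^μ = y^{Aᵀ μ}`, the coefficient of `y^ν` comes from `μ = (Aᵀ)⁻¹ ν`. -/
def changeVars {A : Type} (M : Matrix (Fin r) (Fin r) ℚ) (F : LogSeries r A) : LogSeries r A :=
  fun ν ℓ => F (Matrix.mulVec M.transpose⁻¹ ν) (Matrix.mulVec (M.map (fun x : ℚ => (x : ℂ))) ℓ)

/-- The product `y^κ F`. -/
def mulMonomial {A : Type} (κ : Fin r → ℚ) (F : LogSeries r A) : LogSeries r A :=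
  fun ν ℓ => F (ν - κ) ℓ

/-! ### The `H`-functions -/

/-- The lattice `𝕃` in `𝕃 ⊗ ℚ`. -/
def intLattice (r : ℕ) : AddSubgroup (Fin r → ℚ) :=
  ((Int.castAddHom ℚ).compLeft (Fin r)).range

/-- Labels of the components of the inertia stack: classes modulo `𝕃`. -/
abbrev Sector (r : ℕ) : Type := (Fin r → ℚ) ⧸ intLattice r

/-- Vectors of contact orders with the components of `D_±`. -/
abbrev Contact (D : Fin m → Fin r → ℤ) (ω : Fin r → ℝ) (e : Fin r → ℤ) : Type :=
  relDivisors D ω e → ℚ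

/-- The contact orders `(D_i · d)_i` of a degree `d`. -/
def contact (D : Fin m → Fin r → ℤ) (ω : Fin r → ℝ) (e : Fin r → ℤ) (d : Fin r → ℚ) :
    Contact D ω e :=
  fun i => pair (D i) d

/-- The degrees `d ∈ 𝕂_ω` for the pair `(X_ω, D)`. The extended data of the pair leave out the indices
`i ∈ S_ω` with `D_i · e ≠ 0`, whose divisors are empty in `X_ω` and whose variables are set to zero:
only the `d` with `D_i · d = 0` for these `i` remain. -/
def pairDegrees (D : Fin m → Fin r → ℤ) (ω : Fin r → ℝ) (e : Fin r → ℤ) : Set (Fin r → ℚ) :=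
  {d | d ∈ KSet D ω ∧ ∀ i ∈ extended D ω, pair (D i) e ≠ 0 → pair (D i) d = 0}

/-- The class in `ℂ[[ξ_1, …, ξ_r]]` of `g(x)`, where `x = ∑ χ_a ξ_a` is the first Chern class of
`χ ∈ 𝕃^∨ ⊗ ℂ` and `g` is analytic at `0`: the series `∑_j g^{(j)}(0) x^j / j!`. -/
def charClass (g : ℂ → ℂ) (χ : Fin r → ℂ) : MvPowerSeries (Fin r) ℂ :=
  fun ν => iteratedDeriv ν.degree g 0 * ∏ a, χ a ^ ν a / ((ν a).factorial : ℂ)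

/-- `∏_j Γ(1 + v_j / (2πi) + v_j · d) / ∏_{i ∈ M_0} Γ(1 + D_i / (2πi) + D_i · d)`. -/
def gammaFactor (D : Fin m → Fin r → ℤ) (e : Fin r → ℤ) (E : Fin k → Fin r → ℤ) (d : Fin r → ℚ) :
    MvPowerSeries (Fin r) ℂ :=
  (∏ j, charClass (fun w => Complex.Gamma (1 + w + (pair (E j) d : ℚ)))
      (fun a => (E j a : ℂ) / (2 * Real.pi * Complex.I))) *
    ∏ i ∈ Finset.univ.filter (fun i => pair (D i) e = 0),
      charClass (fun w => (Complex.Gamma (1 + w + (pair (D i) d : ℚ)))⁻¹)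
        (fun a => (D i a : ℂ) / (2 * Real.pi * Complex.I))

/-- The expression of the component of `H` in the sector `f` with contact orders `s`, as a series
with coefficients in the completion `ℂ[[ξ_1, …, ξ_r]]` of `H_K(pt)`, which contains all the classes
`D_i`, `v_j` and `p_a`: it is
`e^{t/(2πi)} ∑_d y^d ∏_j Γ(1 + v_j/(2πi) + v_j·d) / ∏_{i ∈ M_0} Γ(1 + D_i/(2πi) + D_i·d)`
with `t = ∑_a p_a log y_a` and `y^d = ∏_a y_a^{p_a · d}`; the sum is over the degrees `d` with class `f` and
contact orders `s`. Degrees with `v_j · d < 0` for some `j` do not contribute: the `v_j` are nef, so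
that such `d` are not effective and their terms vanish in cohomology. -/
def HExpr (D : Fin m → Fin r → ℤ) (ω : Fin r → ℝ) (e : Fin r → ℤ) (E : Fin k → Fin r → ℤ)
    (p : Fin r → Fin r → ℤ) (f : Sector r) (s : Contact D ω e) :
    LogSeries r (MvPowerSeries (Fin r) ℂ) :=
  fun ν ℓ =>
    charClass Complex.exp (fun b => (∑ a, (p a b : ℂ) * ℓ a) / (2 * Real.pi * Complex.I)) *
      ∑ᶠ d ∈ {d : Fin r → ℚ | d ∈ pairDegrees D ω e ∧ (∀ j, 0 ≤ pair (E j) d) ∧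
        (QuotientAddGroup.mk d : Sector r) = f ∧ contact D ω e d = s ∧ ∀ a, pair (p a) d = ν a},
        gammaFactor D e E d

/-- The preimage in `𝒰_ω` of the stratum of `Y` that carries the classes of the sector `f` with contact
orders `s`: the component `Y^f` of the inertia stack is cut out by the `z_i` with `D_i · f ∉ ℤ`, and the
classes `[·]_s` live on the intersection of the components of the divisor with nonzero contact
order. -/
def stratum (D : Fin m → Fin r → ℤ) (ω : Fin r → ℝ) (e : Fin r → ℤ)
    (σ : Fin k → (Fin m → ℂ) → ℂ) (f : Sector r) (s : Contact D ω e) : Set (Fin m → ℂ) :=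
  {z | z ∈ zeroLocus D ω σ ∧
    (∀ d : Fin r → ℚ, (QuotientAddGroup.mk d : Sector r) = f →
      ∀ i, (¬ ∃ a : ℤ, pair (D i) d = a) → z i = 0) ∧
    ∀ i : relDivisors D ω e, s i ≠ 0 → z i = 0}

/-- The component `H_{(Y, D_Y), f, s}` of the relative `H`-function of the pair `(Y, D_Y)`, with
coefficients in the ambient part of the cohomology of the stratum. -/
def HComponent (D : Fin m → Fin r → ℤ) (ω : Fin r → ℝ) (e : Fin r → ℤ) (E : Fin k → Fin r → ℤ)
    (σ : Fin k → (Fin m → ℂ) → ℂ) (p : Fin r → Fin r → ℤ) (f : Sector r) (s : Contact D ω e) :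
    LogSeries r (AmbientCohomology D (stratum D ω e σ f s)) :=
  fun ν ℓ => Ideal.Quotient.mk _ (HExpr D ω e E p f s ν ℓ)


end Defs

end ToricWall

end

/-! The series on the two sides have the same terms, indexed by degrees that differ by the fixed
vector `dp - dm`, a rational multiple of `e`. Every ingredient of a term is insensitive to this
shift. The Gamma factor involves only the `D_i` with `i ∈ M_0` and the `E_j`, which all vanish on
`e`. The conditions `E_j · d ≥ 0` are unchanged for the same reason.

The shift also matches the index sets. If `d` has the class and contact orders of `dp`, then `d -
dp` is a lattice vector killed by every `D_i` with `D_i · e ≠ 0`: contact orders control the indices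
in `I_±`, and both pairings are zero at the extended ones. Adding this vector to `dm` therefore
stays in `𝕂_-` and preserves the sector and all contact orders (`pairDegrees_translate`).

The monomials remain. Since `p_i · e = 0` for `i < r`, the shift changes only the exponent of `y_r`,
which gives the prefactor. Expanding `p_r^+` in the basis `p^-` and pairing with `e` shows that the
coefficient of `p_r^-` is `-c` (`exists_coefficients`). With these coefficients the change of
variables identifies both the exponents and the class `t`. The signs of `p_r^± · e`, hence `c > 0`,
come from nefness and from the fact that a basis cannot vanish on `e ≠ 0`. -/

namespace ToricWall

variable {r m k n : ℕ}

/-! ### Linearity and symmetry of the pairing. -/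

section Pairing

variable {R : Type*} [CommRing R]

lemma pair_add (χ : Fin r → ℤ) (x y : Fin r → R) : pair χ (x + y) = pair χ x + pair χ y := by
  simp [pair, mul_add, Finset.sum_add_distrib]

lemma pair_sub (χ : Fin r → ℤ) (x y : Fin r → R) : pair χ (x - y) = pair χ x - pair χ y := by
  simp [pair, mul_sub, Finset.sum_sub_distrib]

lemma pair_smul (χ : Fin r → ℤ) (q : R) (x : Fin r → R) : pair χ (q • x) = q * pair χ x := by
  simp only [pair, Finset.mul_sum, Pi.smul_apply, smul_eq_mul]
  exact Finset.sum_congr rfl fun _ _ => by ring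

/-- The pairing of two integral vectors is compatible with extension of scalars. -/
lemma pair_intCast (χ x : Fin r → ℤ) : pair χ (fun b => (x b : R)) = ((pair χ x : ℤ) : R) := by
  simp [pair]

lemma pair_comm_int (χ x : Fin r → ℤ) : pair χ x = pair x χ := by
  simp [pair, mul_comm]

end Pairing

/-! ### Degrees and their translates. -/

lemma exists_int_pair_of_mem_intLattice (χ : Fin r → ℤ) {x : Fin r → ℚ} (hx : x ∈ intLattice r) :
    ∃ a : ℤ, pair χ x = a := by
  obtain ⟨y, rfl⟩ := hx
  exact ⟨pair χ y, pair_intCast χ y⟩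

/-- The set `𝕂_ω` is invariant under translation by `𝕃`. -/
lemma KSet_of_sub_mem_intLattice {D : Fin m → Fin r → ℤ} {ω : Fin r → ℝ} {x y : Fin r → ℚ}
    (hx : x ∈ KSet D ω) (h : y - x ∈ intLattice r) : y ∈ KSet D ω := by
  obtain ⟨I, hI, hIx⟩ := hx
  -- The same anticone serves for `y`, because each `D_i · (y - x)` is an integer.
  refine ⟨I, hI, fun i => (hIx i).trans ?_⟩
  obtain ⟨b, hb⟩ := exists_int_pair_of_mem_intLattice (D i) h
  rw [pair_sub] at hb
  constructor
  · rintro ⟨a, ha⟩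
    exact ⟨a + b, by push_cast; linarith⟩
  · rintro ⟨a, ha⟩
    exact ⟨a - b, by push_cast; linarith⟩

/-- Contact orders record only the non-extended indices; at the extended ones both pairings vanish
by the definition of `pairDegrees`. This is why the extended variables of indices off `M_0` have to
be left out. -/
lemma pair_eq_of_contact_eq {D : Fin m → Fin r → ℤ} {ω : Fin r → ℝ} {e : Fin r → ℤ}
    {x y : Fin r → ℚ} (hx : x ∈ pairDegrees D ω e) (hy : y ∈ pairDegrees D ω e)
    (h : contact D ω e x = contact D ω e y) (i : Fin m) (hi : pair (D i) e ≠ 0) :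
    pair (D i) x = pair (D i) y := by
  by_cases hS : i ∈ extended D ω
  · rw [hx.2 i hS hi, hy.2 i hS hi]
  · exact congrFun h ⟨i, hi, hS⟩

/-- Translation by a multiple of `e` carries the degrees for `ω` with the class and the contact orders
of `x` to degrees for `ω'` with those of `x'`. -/
lemma pairDegrees_translate {D : Fin m → Fin r → ℤ} {ω ω' : Fin r → ℝ} {e : Fin r → ℤ}
    {x x' d d' : Fin r → ℚ} (hx : x ∈ pairDegrees D ω e) (hx' : x' ∈ pairDegrees D ω' e)
    (hd : d ∈ pairDegrees D ω e) (hcl : (QuotientAddGroup.mk d : Sector r) = QuotientAddGroup.mk x)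
    (hct : contact D ω e d = contact D ω e x) (hdd : d' - x' = d - x) :
    d' ∈ pairDegrees D ω' e ∧ (QuotientAddGroup.mk d' : Sector r) = QuotientAddGroup.mk x' ∧
      contact D ω' e d' = contact D ω' e x' := by
  have hL : d' - x' ∈ intLattice r := by
    rw [hdd]
    have := QuotientAddGroup.eq.mp hcl.symm
    rwa [neg_add_eq_sub] at this
  -- The common difference `d - x = d' - x'` is killed by all `D_i` off `M_0`, so it does not matter
  -- that `ω` and `ω'` may have different extended indices.
  have hp : ∀ i, pair (D i) e ≠ 0 → pair (D i) d' = pair (D i) x' := fun i hi => by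
    have h1 := congrArg (pair (D i)) hdd
    rw [pair_sub, pair_sub, pair_eq_of_contact_eq hd hx hct i hi, sub_self] at h1
    exact sub_eq_zero.mp h1
  refine ⟨⟨KSet_of_sub_mem_intLattice hx'.1 hL, fun i hS hi => ?_⟩, ?_, ?_⟩
  · rw [hp i hi, hx'.2 i hS hi]
  · refine (QuotientAddGroup.eq.mpr ?_).symm
    rwa [neg_add_eq_sub]
  · exact funext fun i => hp i i.2.1

/-- The Gamma factor depends only on the class of the degree modulo `e`. -/
lemma gammaFactor_congr {D : Fin m → Fin r → ℤ} {e : Fin r → ℤ} {E : Fin k → Fin r → ℤ}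
    {d d' : Fin r → ℚ} (hE : ∀ j, pair (E j) d = pair (E j) d')
    (hD : ∀ i, pair (D i) e = 0 → pair (D i) d = pair (D i) d') :
    gammaFactor D e E d = gammaFactor D e E d' := by
  unfold gammaFactor
  congr 1
  · exact Finset.prod_congr rfl fun j _ => by rw [hE j]
  · exact Finset.prod_congr rfl fun i hi => by rw [hD i (Finset.mem_filter.mp hi).2]

/-! ### Rational bases and the change of variables -/

/-- `ℚ` is the fraction field of `ℤ`, and independence over a domain and over its fraction field
agree. -/
lemma linearIndependent_rat {ι : Type*} {p : ι → Fin r → ℤ} (hp : LinearIndependent ℤ p) :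
    LinearIndependent ℚ (fun i b => (p i b : ℚ)) := by
  rw [← LinearIndependent.iff_fractionRing ℤ ℚ]
  refine hp.map' ((Int.castAddHom ℚ).toIntLinearMap.compLeft (Fin r)) ?_
  refine LinearMap.ker_eq_bot.mpr fun x y h => funext fun b => ?_
  exact Int.cast_injective (α := ℚ) (congrFun h b)

lemma exists_rat_combination {p : Fin r → Fin r → ℤ} (hp : LinearIndependent ℤ p) (v : Fin r → ℚ) :
    ∃ x : Fin r → ℚ, ∀ b, v b = ∑ a, x a * (p a b : ℚ) := by
  have hs := (linearIndependent_rat hp).span_eq_top_of_card_eq_finrank' (by simp)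
  obtain ⟨x, hx⟩ := (Submodule.mem_span_range_iff_exists_fun ℚ).mp (hs ▸ Submodule.mem_top : v ∈ _)
  exact ⟨x, fun b => by simp [← hx]⟩

/-- A nonzero vector pairs nontrivially with some element of a rational basis. -/
lemma exists_pair_ne_zero {p : Fin r → Fin r → ℤ} (hp : LinearIndependent ℤ p) {e : Fin r → ℤ}
    (he : e ≠ 0) : ∃ a, pair (p a) e ≠ 0 := by
  by_contra! h
  obtain ⟨x, hx⟩ := exists_rat_combination hp (fun b => (e b : ℚ))
  -- Expanding one factor of `e · e` in the basis reduces it to the pairings of the basis with `e`;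
  -- positive definiteness of the dot product then forces `e = 0`.
  have h0 : ∑ b, (e b : ℚ) * e b = 0 := by
    calc ∑ b, (e b : ℚ) * e b = ∑ b, ∑ a, x a * ((p a b : ℚ) * e b) := by
          refine Finset.sum_congr rfl fun b _ => ?_
          nth_rw 1 [hx b]
          rw [Finset.sum_mul]
          exact Finset.sum_congr rfl fun a _ => by ring
      _ = ∑ a, x a * ((pair (p a) e : ℤ) : ℚ) := by
          rw [Finset.sum_comm]
          simp [pair, Finset.mul_sum]
      _ = 0 := by simp [h]
  refine he (funext fun b => ?_)
  have := (Finset.sum_eq_zero_iff_of_nonneg fun b _ => mul_self_nonneg (e b : ℚ)).mp h0 b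
    (Finset.mem_univ b)
  simpa using this

/-! ### Signs on the two sides of the wall, and the constant `c`. -/

lemma IsWallCrossing.ne_zero {D : Fin m → Fin r → ℤ} {ωp ωm : Fin r → ℝ} {e : Fin r → ℤ}
    (h : IsWallCrossing D ωp ωm e) : e ≠ 0 := by
  rintro rfl
  exact not_isUnit_zero (h.primitive 0 0 (by simp))

lemma continuous_pair (e : Fin r → ℤ) : Continuous (fun θ : Fin r → ℝ => pair e θ) := by
  unfold pair
  fun_prop

/-- The closed half-space bounded by the wall contains the chamber, hence its closure. On integral
vectors the dot product is symmetric, which turns this into a sign for `p · e`. -/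
lemma IsWallCrossing.pair_nonneg {D : Fin m → Fin r → ℤ} {ωp ωm : Fin r → ℝ} {e : Fin r → ℤ}
    (h : IsWallCrossing D ωp ωm e) {p : Fin r → ℤ}
    (hp : (fun b => (p b : ℝ)) ∈ closure (chamber D ωp)) : 0 ≤ pair p e := by
  have : 0 ≤ pair e (fun b => (p b : ℝ)) :=
    closure_minimal (t := {θ | 0 ≤ pair e θ}) h.side_p
      (isClosed_le continuous_const (continuous_pair e)) hp
  rw [pair_intCast, pair_comm_int] at this
  exact_mod_cast this

lemma IsWallCrossing.pair_nonpos {D : Fin m → Fin r → ℤ} {ωp ωm : Fin r → ℝ} {e : Fin r → ℤ}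
    (h : IsWallCrossing D ωp ωm e) {p : Fin r → ℤ}
    (hp : (fun b => (p b : ℝ)) ∈ closure (chamber D ωm)) : pair p e ≤ 0 := by
  have : pair e (fun b => (p b : ℝ)) ≤ 0 :=
    closure_minimal (t := {θ | pair e θ ≤ 0}) h.side_m
      (isClosed_le (continuous_pair e) continuous_const) hp
  rw [pair_intCast, pair_comm_int] at this
  exact_mod_cast this

lemma pair_eq_zero_of_mem_wall {e p : Fin r → ℤ} (hp : (fun b => (p b : ℝ)) ∈ wall e) :
    pair p e = 0 := by
  have : pair e (fun b => (p b : ℝ)) = 0 := hp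
  rw [pair_intCast, pair_comm_int] at this
  exact_mod_cast this

namespace AreWallBases

variable {D : Fin m → Fin (n + 1) → ℤ} {ωp ωm : Fin (n + 1) → ℝ} {e : Fin (n + 1) → ℤ}
  {pp pm : Fin (n + 1) → Fin (n + 1) → ℤ}

lemma pair_castSucc_eq_zero (h : AreWallBases D ωp ωm e pp pm) (i : Fin n) :
    pair (pp i.castSucc) e = 0 :=
  pair_eq_zero_of_mem_wall (h.mem_wall i).1

/-- Nefness gives the weak inequality. Equality would make the whole basis vanish on `e`, since its
other elements lie on the wall. -/
lemma pair_last_pos (h : AreWallBases D ωp ωm e pp pm) (hw : IsWallCrossing D ωp ωm e) :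
    0 < pair (pp (Fin.last n)) e := by
  refine lt_of_le_of_ne (hw.pair_nonneg (h.basis_p.nef _)) fun h0 => ?_
  obtain ⟨a, ha⟩ := exists_pair_ne_zero h.basis_p.linearIndependent hw.ne_zero
  induction a using Fin.lastCases with
  | last => exact ha h0.symm
  | cast i => exact ha (h.pair_castSucc_eq_zero i)

lemma pair_last_neg (h : AreWallBases D ωp ωm e pp pm) (hw : IsWallCrossing D ωp ωm e) :
    pair (pm (Fin.last n)) e < 0 := by
  refine lt_of_le_of_ne (hw.pair_nonpos (h.basis_m.nef _)) fun h0 => ?_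
  obtain ⟨a, ha⟩ := exists_pair_ne_zero h.basis_m.linearIndependent hw.ne_zero
  induction a using Fin.lastCases with
  | last => exact ha h0
  | cast i => exact ha (h.common i ▸ h.pair_castSucc_eq_zero i)

/-- The last element of the basis `p⁺` in terms of the basis `p⁻`. -/
lemma exists_coefficients (h : AreWallBases D ωp ωm e pp pm) (hw : IsWallCrossing D ωp ωm e) :
    ∃ cs : Fin n → ℚ, ∀ b, (pp (Fin.last n) b : ℚ) =
      (∑ i, cs i * (pm (Fin.castSucc i) b : ℚ)) -
        -((pair (pp (Fin.last n)) e : ℤ) : ℚ) / ((pair (pm (Fin.last n)) e : ℤ) : ℚ) *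
          (pm (Fin.last n) b : ℚ) := by
  obtain ⟨x, hx⟩ := exists_rat_combination h.basis_m.linearIndependent
    (fun b => (pp (Fin.last n) b : ℚ))
  simp only [Fin.sum_univ_castSucc] at hx
  have hne : ((pair (pm (Fin.last n)) e : ℤ) : ℚ) ≠ 0 := by
    exact_mod_cast (h.pair_last_neg hw).ne
  -- Pairing the expansion of `p_r^+` with `e` kills the basis elements on the wall and isolates the
  -- last coefficient, which is therefore `-c`.
  have hpair : ((pair (pp (Fin.last n)) e : ℤ) : ℚ) =
      x (Fin.last n) * ((pair (pm (Fin.last n)) e : ℤ) : ℚ) := by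
    have h0 : ∀ i : Fin n, ∑ b, (pm i.castSucc b : ℚ) * e b = 0 := fun i => by
      have := h.pair_castSucc_eq_zero i
      rw [h.common i] at this
      have h2 : ((pair (pm i.castSucc) e : ℤ) : ℚ) = 0 := by rw [this]; simp
      simpa [pair] using h2
    simp only [pair, Int.cast_sum, Int.cast_mul, Int.cast_id]
    simp only [hx, add_mul, Finset.sum_add_distrib, Finset.sum_mul, Finset.mul_sum]
    rw [Finset.sum_comm]
    simp only [mul_assoc, ← Finset.mul_sum, h0]
    simp
  refine ⟨fun i => x i.castSucc, fun b => ?_⟩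
  rw [hx b, hpair, neg_div, mul_div_cancel_right₀ _ hne]
  ring

end AreWallBases

/-! ### The matrix of the change of variables. -/

/-- The matrix itself acts on logarithms: these are the formulas for `log ỹ_a`. -/
lemma changeMatrix_mulVec {R : Type*} [CommRing R] [Algebra ℚ R] (cs : Fin n → ℚ) (c : ℚ)
    (ℓ : Fin (n + 1) → R) :
    ((changeMatrix cs c).map (algebraMap ℚ R)).mulVec ℓ =
      Fin.snoc (α := fun _ => R) (fun i => ℓ i.castSucc + algebraMap ℚ R (cs i) * ℓ (Fin.last n))
        (-(algebraMap ℚ R c * ℓ (Fin.last n))) := by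
  funext a
  induction a using Fin.lastCases with
  | last => simp [changeMatrix, Matrix.mulVec, dotProduct, Fin.sum_univ_castSucc]
  | cast i =>
    simp [changeMatrix, Matrix.mulVec, dotProduct, Fin.sum_univ_castSucc, Pi.single_apply,
      apply_ite, ite_mul]

/-- The transpose acts on exponents: collecting powers of `y_r` in `ỹ^μ` gives the last entry. -/
lemma changeMatrix_transpose_mulVec (cs : Fin n → ℚ) (c : ℚ) (μ : Fin (n + 1) → ℚ) :
    (changeMatrix cs c).transpose.mulVec μ =
      Fin.snoc (α := fun _ => ℚ) (fun i => μ i.castSucc)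
        ((∑ i, cs i * μ i.castSucc) - c * μ (Fin.last n)) := by
  funext a
  induction a using Fin.lastCases with
  | last =>
    simp [changeMatrix, Matrix.mulVec, dotProduct, Fin.sum_univ_castSucc, sub_eq_add_neg]
  | cast i =>
    simp [changeMatrix, Matrix.mulVec, dotProduct, Fin.sum_univ_castSucc, Pi.single_apply]

/-- The matrix is triangular with diagonal `1, …, 1, -c`; injectivity is read off one coordinate at
a time, the last one after cancelling `c`. -/
lemma isUnit_det_changeMatrix_transpose (cs : Fin n → ℚ) {c : ℚ} (hc : c ≠ 0) :
    IsUnit (changeMatrix cs c).transpose.det := by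
  rw [← Matrix.isUnit_iff_isUnit_det, ← Matrix.mulVec_injective_iff_isUnit]
  intro μ μ' h
  simp only [changeMatrix_transpose_mulVec] at h
  have h1 : ∀ i : Fin n, μ i.castSucc = μ' i.castSucc := fun i => by
    simpa using congrFun h i.castSucc
  have h2 := congrFun h (Fin.last n)
  simp only [Fin.snoc_last, h1] at h2
  funext a
  induction a using Fin.lastCases with
  | last => exact mul_left_cancel₀ hc (sub_right_injective h2)
  | cast i => exact h1 i

/-- Removes the matrix inverse in `changeVars`. Invertibility is essential, as the inverse of a
singular matrix is the default value `0`. -/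
lemma changeMatrix_transpose_inv_mulVec_eq_iff (cs : Fin n → ℚ) {c : ℚ} (hc : c ≠ 0)
    (μ ν : Fin (n + 1) → ℚ) :
    μ = (changeMatrix cs c).transpose⁻¹.mulVec ν ↔ (changeMatrix cs c).transpose.mulVec μ = ν := by
  have hu := isUnit_det_changeMatrix_transpose cs hc
  constructor
  · rintro rfl
    rw [Matrix.mulVec_mulVec, Matrix.mul_nonsing_inv _ hu, Matrix.one_mulVec]
  · rintro rfl
    rw [Matrix.mulVec_mulVec, Matrix.nonsing_inv_mul _ hu, Matrix.one_mulVec]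

/-- The class `t = ∑_a p_a log y_a` is invariant under the change of variables. -/
lemma sum_mul_changeMatrix_mulVec {pp pm : Fin (n + 1) → Fin (n + 1) → ℤ}
    (hcommon : ∀ i : Fin n, pp i.castSucc = pm i.castSucc) {cs : Fin n → ℚ} {c : ℚ}
    (hlast : ∀ b, (pp (Fin.last n) b : ℚ) =
      (∑ i, cs i * (pm (Fin.castSucc i) b : ℚ)) - c * (pm (Fin.last n) b : ℚ))
    (ℓ : Fin (n + 1) → ℂ) (b : Fin (n + 1)) :
    ∑ a, (pm a b : ℂ) * ((changeMatrix cs c).map (fun x : ℚ => (x : ℂ))).mulVec ℓ a =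
      ∑ a, (pp a b : ℂ) * ℓ a := by
  have h := changeMatrix_mulVec (R := ℂ) cs c ℓ
  simp only [eq_ratCast] at h
  have hlast' : (pp (Fin.last n) b : ℂ) =
      (∑ i, (cs i : ℂ) * (pm (Fin.castSucc i) b : ℂ)) - c * (pm (Fin.last n) b : ℂ) := by
    exact_mod_cast congrArg (fun x : ℚ => (x : ℂ)) (hlast b)
  rw [show ((changeMatrix cs c).map (fun x : ℚ => (x : ℂ))).mulVec ℓ = _ from h]
  -- On both sides the coefficient of the last logarithm is `∑ c_i p_i^- - c p_r^- = p_r^+`.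
  simp only [Fin.sum_univ_castSucc, Fin.snoc_castSucc, Fin.snoc_last, hcommon, hlast', mul_add,
    Finset.sum_add_distrib, sub_mul, Finset.sum_mul]
  rw [show ∑ i : Fin n, (pm i.castSucc b : ℂ) * (cs i * ℓ (Fin.last n)) =
    ∑ i : Fin n, cs i * (pm i.castSucc b : ℂ) * ℓ (Fin.last n) from
      Finset.sum_congr rfl fun i _ => by ring]
  ring

/-- The exponents of a degree with respect to the two bases are related by the change of
variables. -/
lemma changeMatrix_transpose_mulVec_pair {pp pm : Fin (n + 1) → Fin (n + 1) → ℤ}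
    (hcommon : ∀ i : Fin n, pp i.castSucc = pm i.castSucc) {cs : Fin n → ℚ} {c : ℚ}
    (hlast : ∀ b, (pp (Fin.last n) b : ℚ) =
      (∑ i, cs i * (pm (Fin.castSucc i) b : ℚ)) - c * (pm (Fin.last n) b : ℚ))
    (d : Fin (n + 1) → ℚ) :
    (changeMatrix cs c).transpose.mulVec (fun a => pair (pm a) d) = fun a => pair (pp a) d := by
  rw [changeMatrix_transpose_mulVec]
  funext a
  induction a using Fin.lastCases with
  | last =>
    simp only [Fin.snoc_last, pair, hlast, sub_mul, Finset.sum_sub_distrib, Finset.sum_mul,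
      Finset.mul_sum]
    rw [Finset.sum_comm]
    simp only [mul_assoc]
  | cast i => simp [hcommon]

/-! ### Comparison of the `H`-functions. -/

/-- The relation between the expressions of the `H`-functions under the change of variables. -/
lemma HExpr_eq_mulMonomial_changeVars {D : Fin m → Fin (n + 1) → ℤ} {ωp ωm : Fin (n + 1) → ℝ}
    {e : Fin (n + 1) → ℤ} {E : Fin k → Fin (n + 1) → ℤ} (hE : ∀ j, pair (E j) e = 0)
    {pp pm : Fin (n + 1) → Fin (n + 1) → ℤ}
    (hcommon : ∀ i : Fin n, pp i.castSucc = pm i.castSucc)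
    (hpe : ∀ i : Fin n, pair (pp i.castSucc) e = 0) {cs : Fin n → ℚ} {c : ℚ} (hc : c ≠ 0)
    (hlast : ∀ b, (pp (Fin.last n) b : ℚ) =
      (∑ i, cs i * (pm (Fin.castSucc i) b : ℚ)) - c * (pm (Fin.last n) b : ℚ))
    {dp dm : Fin (n + 1) → ℚ} (hdp : dp ∈ pairDegrees D ωp e) (hdm : dm ∈ pairDegrees D ωm e)
    {q : ℚ} (hq : dp - dm = q • fun b => (e b : ℚ)) :
    HExpr D ωp e E pp (QuotientAddGroup.mk dp) (contact D ωp e dp) =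
      mulMonomial (Pi.single (Fin.last n) (pair (pp (Fin.last n)) (dp - dm)))
        (changeVars (changeMatrix cs c)
          (HExpr D ωm e E pm (QuotientAddGroup.mk dm) (contact D ωm e dm))) := by
  have hpair : ∀ χ : Fin (n + 1) → ℤ, pair χ e = 0 → pair χ (dp - dm) = 0 := fun χ hχ => by
    rw [hq, pair_smul, pair_intCast, hχ, Int.cast_zero, mul_zero]
  -- The shift is a multiple of `e`, so only `p_r^+` sees it: the monomial `y_r^{p_r^+ · (dp - dm)}`
  -- is the full monomial of the degree `dp - dm`.
  have hκ : (Pi.single (Fin.last n) (pair (pp (Fin.last n)) (dp - dm)) : Fin (n + 1) → ℚ) =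
      fun a => pair (pp a) (dp - dm) := by
    funext a
    induction a using Fin.lastCases with
    | last => simp
    | cast i => simp [hpair _ (hpe i)]
  funext ν ℓ
  simp only [HExpr, mulMonomial, changeVars, sum_mul_changeMatrix_mulVec hcommon hlast]
  -- The exponential prefactors already agree by invariance of `t`; only the sums over degrees are
  -- left.
  congr 1
  have hexp : ∀ d : Fin (n + 1) → ℚ, (∀ a, pair (pp a) d = ν a) ↔
      ∀ a, pair (pm a) (d - (dp - dm)) = (changeMatrix cs c).transpose⁻¹.mulVec
        (ν - Pi.single (Fin.last n) (pair (pp (Fin.last n)) (dp - dm))) a := fun d => by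
    rw [← funext_iff, ← funext_iff, changeMatrix_transpose_inv_mulVec_eq_iff cs hc,
      changeMatrix_transpose_mulVec_pair hcommon hlast, hκ]
    simp only [funext_iff, pair_sub, Pi.sub_apply, sub_left_inj]
  -- A bijection with equal terms transports the finite-support sum whatever its support, so no
  -- finiteness has to be checked.
  refine finsum_mem_eq_of_bijOn (fun d => d - (dp - dm)) ⟨?_, ?_, ?_⟩ ?_
  · rintro d ⟨hd, hEd, hcl, hct, hν⟩
    obtain ⟨h1, h2, h3⟩ := pairDegrees_translate (d' := d - (dp - dm)) hdp hdm hd hcl hct (by abel)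
    exact ⟨h1, fun j => by rw [pair_sub, hpair _ (hE j), sub_zero]; exact hEd j, h2, h3,
      (hexp d).mp hν⟩
  · exact fun x _ y _ h => sub_left_injective h
  · rintro d ⟨hd, hEd, hcl, hct, hν⟩
    obtain ⟨h1, h2, h3⟩ := pairDegrees_translate (d' := d + (dp - dm)) hdm hdp hd hcl hct (by abel)
    refine ⟨d + (dp - dm), ⟨h1, fun j => ?_, h2, h3, ?_⟩, add_sub_cancel_right _ _⟩
    · rw [pair_add, hpair _ (hE j), add_zero]
      exact hEd j
    · rw [hexp, add_sub_cancel_right]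
      exact hν
  · intro d _
    exact gammaFactor_congr (fun j => by rw [pair_sub, hpair _ (hE j), sub_zero])
      fun i hi => by rw [pair_sub, hpair _ hi, sub_zero]

end ToricWall

theorem mainTheorem2 {n m k : ℕ}
    (D : Fin m → Fin (n + 1) → ℤ) (ωp ωm : Fin (n + 1) → ℝ) (e : Fin (n + 1) → ℤ)
    (hwall : ToricWall.IsWallCrossing D ωp ωm e)
    (E : Fin k → Fin (n + 1) → ℤ) (sp sm : Fin k → (Fin m → ℂ) → ℂ)
    (hci : ToricWall.IsCompatibleCI D ωp ωm e E sp sm)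
    (pp pm : Fin (n + 1) → Fin (n + 1) → ℤ)
    (hbasis : ToricWall.AreWallBases D ωp ωm e pp pm) :
    ∃ (cs : Fin n → ℚ) (c : ℚ), 0 < c ∧
      c = -((ToricWall.pair (pp (Fin.last n)) e : ℤ) : ℚ) /
        ((ToricWall.pair (pm (Fin.last n)) e : ℤ) : ℚ) ∧
      (∀ b, (pp (Fin.last n) b : ℚ) =
        (∑ i, cs i * (pm (Fin.castSucc i) b : ℚ)) - c * (pm (Fin.last n) b : ℚ)) ∧
      ∀ dp ∈ ToricWall.pairDegrees D ωp e, ∀ dm ∈ ToricWall.pairDegrees D ωm e,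
        (∃ q : ℚ, ∀ b, dp b - dm b = q * (e b : ℚ)) →
        ∀ κ : Fin (n + 1) → ℚ,
          κ = Pi.single (Fin.last n) (ToricWall.pair (pp (Fin.last n)) (dp - dm)) →
          ToricWall.HExpr D ωp e E pp (QuotientAddGroup.mk dp) (ToricWall.contact D ωp e dp) =
            ToricWall.mulMonomial κ (ToricWall.changeVars (ToricWall.changeMatrix cs c)
              (ToricWall.HExpr D ωm e E pm (QuotientAddGroup.mk dm)
                (ToricWall.contact D ωm e dm))) ∧
          (∀ ν ℓ,
            ToricWall.HComponent D ωp e E sp pp (QuotientAddGroup.mk dp)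
                (ToricWall.contact D ωp e dp) ν ℓ =
              Ideal.Quotient.mk _
                (ToricWall.mulMonomial κ (ToricWall.changeVars (ToricWall.changeMatrix cs c)
                  (ToricWall.HExpr D ωm e E pm (QuotientAddGroup.mk dm)
                    (ToricWall.contact D ωm e dm))) ν ℓ)) ∧
          (∀ ν ℓ,
            ToricWall.mulMonomial κ (ToricWall.changeVars (ToricWall.changeMatrix cs c)
                (ToricWall.HComponent D ωm e E sm pm (QuotientAddGroup.mk dm)
                  (ToricWall.contact D ωm e dm))) ν ℓ =
              Ideal.Quotient.mk _
                (ToricWall.HExpr D ωp e E pp (QuotientAddGroup.mk dp)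
                  (ToricWall.contact D ωp e dp) ν ℓ)) := by
  obtain ⟨cs, hlast⟩ := hbasis.exists_coefficients hwall
  have hc : 0 < -((ToricWall.pair (pp (Fin.last n)) e : ℤ) : ℚ) /
      ((ToricWall.pair (pm (Fin.last n)) e : ℤ) : ℚ) :=
    -- Numerator and denominator are both negative, as `p_r^+ · e > 0 > p_r^- · e`.
    div_pos_of_neg_of_neg (by exact_mod_cast neg_neg_of_pos (hbasis.pair_last_pos hwall))
      (by exact_mod_cast hbasis.pair_last_neg hwall)
  refine ⟨cs, _, hc, rfl, hlast, ?_⟩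
  rintro dp hdp dm hdm ⟨q, hq⟩ κ rfl
  have key := ToricWall.HExpr_eq_mulMonomial_changeVars (E := E)
    (fun j => ToricWall.pair_eq_zero_of_mem_wall (hci.mem_wall j).1) hbasis.common
    hbasis.pair_castSucc_eq_zero hc.ne' hlast hdp hdm (funext hq)
  refine ⟨key, fun ν ℓ => ?_, fun ν ℓ => ?_⟩
  -- Components are coefficientwise quotients of the expressions, and the substitution and the
  -- monomial act only on the arguments `ν`, `ℓ`. They thus commute with the quotient map by
  -- definition, although the two strata have different cohomology rings.
  · rw [← key]
    rfl
  · rw [key]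
    rfl
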